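/- Let $\delta$ be a regular cardinal and let $\gamma\le\delta$ be a cardinal. **Logic.** $\mathcal L_{\delta,\gamma}$ is the propositional logic with variables $a_\xi$ ($\xi<\gamma$), the connectives $\lnot,\wedge,\vee,\rightarrow,\leftrightarrow$, and conjunctions $\bigwedge_{\xi<\kappa}\varphi_\xi$ and disjunctions $\bigvee_{\xi<\kappa}\varphi_\xi$ of all lengths $\kappa<\delta$. Formulas are identified in the usual way with sets in $V_\delta$, and a sequence $\langle\varphi_\xi:\xi<\delta\rangle$ of formulas with the subset $\{(\xi,\varphi_\xi):\xi<\delta\}$ of $V_\delta$. For a theory $\mathcal T$, the relation $\mathcal T\vdash\varphi$ is given by the axioms and rules of classical propositional logic, the axioms $\bigvee_\xi\lnot\varphi_\xi\leftrightarrow\lnot\bigwedge_\xi\varphi_\xi$, $\bigwedge_\xi\lnot\varphi_\xi\leftrightarrow\lnot\bigvee_\xi\varphi_\xi$ and $\bigwedge_{\xi}\varphi_\xi\rightarrow\varphi_\eta$, and the rules: from all $\varphi_\xi$ ($\xi<\kappa$) infer $\bigwedge_{\xi<\kappa}\varphi_\xi$, and from all $\chi\rightarrow\varphi_\xi$ ($\xi<\kappa$)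 infer $\chi\rightarrow\bigwedge_{\xi<\kappa}\varphi_\xi$. The Lindenbaum algebra $\mathcal B_{\delta,\gamma}/\mathcal T$ is the Boolean algebra of formulas modulo the relation $\mathcal T\vdash\varphi\leftrightarrow\psi$. **Extenders.** Let $\kappa<\nu$ be uncountable cardinals. A $(\kappa,\nu)$-extender is a family $E=\langle E_s: s\in[\nu]^{<\omega}\rangle$ of $\kappa$-complete ultrafilters $E_s$ on $[\kappa]^{|s|}$, nonprincipal whenever $s\not\subseteq\kappa$, which is coherent under the natural projections, normal, and countably complete. Its ultrapower, the direct limit of the ultrapowers $\mathrm{Ult}(V,E_s)$, is identified with its transitive collapse $\mathrm{Ult}(V,E)$, and $j_E\colon V\to\mathrm{Ult}(V,E)$ is the canonical embedding. An elementary embedding $j\colon V\to M$ into a transitive class is $A,\lambda$-strong if $V_\lambda\subseteq M$ and $j(A)\cap V_\lambda=A\cap V_\lambda$. The cardinal $\delta$ is Woodin if for every $A\subseteq V_\delta$ there is $\kappa<\delta$ such that for arbitrarily large $\lambda<\delta$ there is an $A,\lambda$-strong elementary embedding with critical point $\kappa$. For a set $\vec E$ of extenders, we say that $\vec E$ witnesses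 that $A$ reflects to $\kappa<\delta$ if for every $\lambda$ with $\kappa<\lambda<\delta$ there is $E\in\vec E$ such that $j_E$ has critical point $\kappa$ and is $A,\lambda$-strong. We say that $\vec E$ witnesses the Woodinness of $\delta$ if every member of $\vec E$ belongs to $V_\delta$ and for every $A\subseteq V_\delta$ there is $\kappa<\delta$ such that $\vec E$ witnesses that $A$ reflects to $\kappa$. **Extender algebra.** $\mathcal T_{\delta,\gamma}(\vec E)$ is the deductive closure of the set of all sentences $$\bigvee_{\xi<\kappa}\varphi_\xi\leftrightarrow\bigvee_{\xi<\lambda}\varphi_\xi ,$$ where $\vec\varphi=\langle\varphi_\xi:\xi<\delta\rangle$ is a sequence of formulas of $\mathcal L_{\delta,\gamma}$, $\kappa<\delta$ is such that $\vec E$ witnesses that $\vec\varphi$ reflects to $\kappa$, and $\kappa\le\lambda<\delta$. The extender algebra is $\mathcal W_{\delta,\gamma}(\vec E)=\mathcal B_{\delta,\gamma}/\mathcal T_{\delta,\gamma}(\vec E)$. **Theorem.** If $\delta$ is a Woodin cardinal and $\vec E$ is a system of extenders witnessing its Woodinness, then $\mathcal W_{\delta,\gamma}(\vec E)$ has the $\delta$-chain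 condition (every antichain of nonzero elements has cardinality less than $\delta$), and $\mathcal W_{\delta,\gamma}(\vec E)$ is a complete Boolean algebra. -/

import Mathlib

universe u

namespace ExtenderAlgebra

open Cardinal Ordinal ZFSet

/-! ### The infinitary propositional logic -/

/-- Formulas of the infinitary propositional logic with variables `a_ξ` (`ξ < γ`), the finitary
connectives, and conjunctions and disjunctions of every length `κ < δ`. -/
inductive Formula (δ γ : Cardinal.{u}) : Type (u + 1)
  | var (ξ : Set.Iio γ.ord) : Formula δ γ
  | neg (φ : Formula δ γ) : Formula δ γ
  | and (φ ψ : Formula δ γ) : Formula δ γ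
  | or (φ ψ : Formula δ γ) : Formula δ γ
  | imp (φ ψ : Formula δ γ) : Formula δ γ
  | iff (φ ψ : Formula δ γ) : Formula δ γ
  | bigAnd (κ : Set.Iio δ.ord) (φ : Set.Iio κ.1 → Formula δ γ) : Formula δ γ
  | bigOr (κ : Set.Iio δ.ord) (φ : Set.Iio κ.1 → Formula δ γ) : Formula δ γ

namespace Formula

variable {δ γ : Cardinal.{u}}

/-- The set which a formula is. A sequence of sets is, as usual, its graph. -/
noncomputable def code : Formula δ γ → ZFSet.{u}
  | var ξ => pair (toZFSet 0) (toZFSet ξ.1)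
  | neg φ => pair (toZFSet 1) φ.code
  | and φ ψ => pair (toZFSet 2) (pair φ.code ψ.code)
  | or φ ψ => pair (toZFSet 3) (pair φ.code ψ.code)
  | imp φ ψ => pair (toZFSet 4) (pair φ.code ψ.code)
  | iff φ ψ => pair (toZFSet 5) (pair φ.code ψ.code)
  | bigAnd κ φ => pair (toZFSet 6)
      (ZFSet.range fun ξ : Set.Iio κ.1 => pair (toZFSet ξ.1) (φ ξ).code)
  | bigOr κ φ => pair (toZFSet 7)
      (ZFSet.range fun ξ : Set.Iio κ.1 => pair (toZFSet ξ.1) (φ ξ).code)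

/-- The sequence `⟨φ_ξ : ξ < δ⟩` as a set, namely the set of pairs `(ξ, φ_ξ)`. -/
noncomputable def codeSeq (φ : Set.Iio δ.ord → Formula δ γ) : ZFSet.{u} :=
  ZFSet.range fun ξ : Set.Iio δ.ord => pair (toZFSet ξ.1) (φ ξ).code

/-- The disjunction of the first `κ` members of a sequence of length `δ`, for `κ < δ`. -/
def initialOr (φ : Set.Iio δ.ord → Formula δ γ) (κ : Set.Iio δ.ord) : Formula δ γ :=
  bigOr κ fun ξ => φ ⟨ξ.1, lt_trans (Set.mem_Iio.1 ξ.2) (Set.mem_Iio.1 κ.2)⟩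

end Formula

open Formula

/-- Provability from a theory: the least set of formulas that contains the theory and the logical
axioms, and is closed under modus ponens and the infinitary rules. -/
inductive Provable {δ γ : Cardinal.{u}} (T : Set (Formula δ γ)) : Formula δ γ → Prop
  | ax {φ : Formula δ γ} : φ ∈ T → Provable T φ
  | mp {φ ψ : Formula δ γ} : Provable T (φ.imp ψ) → Provable T φ → Provable T ψ
  | imp_k (φ ψ : Formula δ γ) : Provable T (φ.imp (ψ.imp φ))
  | imp_s (φ ψ χ : Formula δ γ) : Provable T ((φ.imp (ψ.imp χ)).imp ((φ.imp ψ).imp (φ.imp χ)))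
  | and_left (φ ψ : Formula δ γ) : Provable T ((φ.and ψ).imp φ)
  | and_right (φ ψ : Formula δ γ) : Provable T ((φ.and ψ).imp ψ)
  | and_intro (φ ψ : Formula δ γ) : Provable T (φ.imp (ψ.imp (φ.and ψ)))
  | or_inl (φ ψ : Formula δ γ) : Provable T (φ.imp (φ.or ψ))
  | or_inr (φ ψ : Formula δ γ) : Provable T (ψ.imp (φ.or ψ))
  | or_elim (φ ψ χ : Formula δ γ) : Provable T ((φ.imp χ).imp ((ψ.imp χ).imp ((φ.or ψ).imp χ)))
  | neg_intro (φ ψ : Formula δ γ) : Provable T ((φ.imp ψ).imp ((φ.imp ψ.neg).imp φ.neg))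
  | neg_neg (φ : Formula δ γ) : Provable T (φ.neg.neg.imp φ)
  | iff_mp (φ ψ : Formula δ γ) : Provable T ((φ.iff ψ).imp (φ.imp ψ))
  | iff_mpr (φ ψ : Formula δ γ) : Provable T ((φ.iff ψ).imp (ψ.imp φ))
  | iff_intro (φ ψ : Formula δ γ) : Provable T ((φ.imp ψ).imp ((ψ.imp φ).imp (φ.iff ψ)))
  | bigOr_neg (κ : Set.Iio δ.ord) (φ : Set.Iio κ.1 → Formula δ γ) :
      Provable T ((bigOr κ fun ξ => (φ ξ).neg).iff (bigAnd κ φ).neg)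
  | bigAnd_neg (κ : Set.Iio δ.ord) (φ : Set.Iio κ.1 → Formula δ γ) :
      Provable T ((bigAnd κ fun ξ => (φ ξ).neg).iff (bigOr κ φ).neg)
  | bigAnd_elim (κ : Set.Iio δ.ord) (φ : Set.Iio κ.1 → Formula δ γ) (η : Set.Iio κ.1) :
      Provable T ((bigAnd κ φ).imp (φ η))
  | bigAnd_rule (κ : Set.Iio δ.ord) (φ : Set.Iio κ.1 → Formula δ γ) :
      (∀ ξ, Provable T (φ ξ)) → Provable T (bigAnd κ φ)
  | bigAnd_rule_imp (χ : Formula δ γ) (κ : Set.Iio δ.ord) (φ : Set.Iio κ.1 → Formula δ γ) :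
      (∀ ξ, Provable T (χ.imp (φ ξ))) → Provable T (χ.imp (bigAnd κ φ))

/-- The deductive closure of a set of formulas. -/
def deductiveClosure {δ γ : Cardinal.{u}} (T : Set (Formula δ γ)) : Set (Formula δ γ) :=
  {φ | Provable T φ}

/-! ### The Lindenbaum algebra -/

namespace Provable

variable {δ γ : Cardinal.{u}} {T : Set (Formula δ γ)} {φ ψ χ : Formula δ γ}

theorem weaken (h : Provable T φ) : Provable T (ψ.imp φ) := mp (imp_k _ _) h

theorem mp_imp (h : Provable T (χ.imp (φ.imp ψ))) (h' : Provable T (χ.imp φ)) :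
    Provable T (χ.imp ψ) := mp (mp (imp_s _ _ _) h) h'

theorem imp_refl (φ : Formula δ γ) : Provable T (φ.imp φ) :=
  mp (mp (imp_s φ (φ.imp φ) φ) (imp_k _ _)) (imp_k _ _)

theorem imp_trans (h : Provable T (φ.imp ψ)) (h' : Provable T (ψ.imp χ)) :
    Provable T (φ.imp χ) := mp_imp (weaken h') h

theorem imp_and (h : Provable T (χ.imp φ)) (h' : Provable T (χ.imp ψ)) :
    Provable T (χ.imp (φ.and ψ)) := mp_imp (mp_imp (weaken (and_intro _ _)) h) h'

theorem or_imp (h : Provable T (φ.imp χ)) (h' : Provable T (ψ.imp χ)) :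
    Provable T ((φ.or ψ).imp χ) := mp (mp (or_elim _ _ _) h) h'

theorem curry (h : Provable T ((φ.and ψ).imp χ)) : Provable T (φ.imp (ψ.imp χ)) := by
  have h1 : Provable T (φ.imp ((ψ.imp (φ.and ψ)).imp (ψ.imp χ))) :=
    weaken (mp (imp_s _ _ _) (weaken h))
  exact mp_imp h1 (and_intro _ _)

theorem uncurry (h : Provable T (φ.imp (ψ.imp χ))) : Provable T ((φ.and ψ).imp χ) :=
  mp_imp (imp_trans (and_left _ _) h) (and_right _ _)

theorem iff_iff : Provable T (φ.iff ψ) ↔ Provable T (φ.imp ψ) ∧ Provable T (ψ.imp φ) :=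
  ⟨fun h => ⟨mp (iff_mp _ _) h, mp (iff_mpr _ _) h⟩,
    fun h => mp (mp (iff_intro _ _) h.1) h.2⟩

theorem explode (φ χ : Formula δ γ) : Provable T ((φ.and φ.neg).imp χ) := by
  refine imp_trans ?_ (neg_neg χ)
  refine mp_imp (mp_imp (weaken (neg_intro χ.neg φ)) ?_) ?_
  · exact imp_trans (and_left _ _) (imp_k _ _)
  · exact imp_trans (and_right _ _) (imp_k _ _)

theorem contra (h : Provable T (φ.imp ψ)) : Provable T (ψ.neg.imp φ.neg) :=
  mp_imp (mp_imp (weaken (neg_intro φ ψ)) (weaken h)) (imp_k _ _)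

theorem em (φ : Formula δ γ) : Provable T (φ.or φ.neg) := by
  refine mp (neg_neg _) (mp (mp (neg_intro _ φ.neg) ?_) ?_)
  · exact contra (or_inl _ _)
  · exact contra (or_inr _ _)

theorem distrib (φ ψ χ : Formula δ γ) :
    Provable T (((φ.or ψ).and (φ.or χ)).imp (φ.or (ψ.and χ))) := by
  refine uncurry (or_imp ?_ ?_)
  · exact curry (imp_trans (and_left _ _) (or_inl _ _))
  · refine curry ?_
    refine mp_imp (φ := φ.or χ) (imp_trans (and_left _ _) ?_) (and_right _ _)
    have h : Provable T ((φ.or χ).imp (ψ.imp (φ.or (ψ.and χ)))) := by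
      refine or_imp ?_ ?_
      · exact curry (imp_trans (and_left _ _) (or_inl _ _))
      · exact curry (imp_trans (imp_and (and_right _ _) (and_left _ _)) (or_inr _ _))
    exact curry (imp_trans (imp_and (and_right _ _) (and_left _ _)) (uncurry h))

end Provable

open Provable

/-- Equivalence of formulas modulo a theory. -/
def equivMod {δ γ : Cardinal.{u}} (T : Set (Formula δ γ)) : Setoid (Formula δ γ) where
  r φ ψ := Provable T (φ.iff ψ)
  iseqv :=
    ⟨fun φ => iff_iff.2 ⟨imp_refl φ, imp_refl φ⟩,
      fun h => iff_iff.2 (iff_iff.1 h).symm,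
      fun h h' => iff_iff.2 ⟨imp_trans (iff_iff.1 h).1 (iff_iff.1 h').1,
        imp_trans (iff_iff.1 h').2 (iff_iff.1 h).2⟩⟩

/-- The Lindenbaum algebra of a theory: formulas modulo provable equivalence. -/
def Lindenbaum {δ γ : Cardinal.{u}} (T : Set (Formula δ γ)) : Type (u + 1) :=
  Quotient (equivMod T)

/-- The class of a formula in the Lindenbaum algebra. -/
def Lindenbaum.mk {δ γ : Cardinal.{u}} (T : Set (Formula δ γ)) (φ : Formula δ γ) :
    Lindenbaum T := Quotient.mk (equivMod T) φ

/-- The empty conjunction, which is a formula since `0 < δ`. -/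
def Formula.verum {δ : Cardinal.{u}} [h : Fact δ.IsRegular] (γ : Cardinal.{u}) : Formula δ γ :=
  bigAnd ⟨0, Cardinal.ord_pos.2 h.out.pos⟩ fun ξ => (not_lt_zero (Set.mem_Iio.1 ξ.2)).elim

theorem Provable.verum {δ γ : Cardinal.{u}} [Fact δ.IsRegular] {T : Set (Formula δ γ)} :
    Provable T (Formula.verum γ) :=
  bigAnd_rule _ _ fun ξ => (not_lt_zero (Set.mem_Iio.1 ξ.2)).elim

/-- The Boolean algebra structure: `[φ] ≤ [ψ]` means that `φ → ψ` is provable, and the operations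
are induced by the connectives. -/
instance {δ γ : Cardinal.{u}} [Fact δ.IsRegular] (T : Set (Formula δ γ)) :
    BooleanAlgebra (Lindenbaum T) where
  le := Quotient.lift₂ (fun φ ψ => Provable T (φ.imp ψ)) fun _ _ _ _ h h' =>
    propext ⟨fun H => imp_trans (iff_iff.1 h).2 (imp_trans H (iff_iff.1 h').1),
      fun H => imp_trans (iff_iff.1 h).1 (imp_trans H (iff_iff.1 h').2)⟩
  le_refl := by rintro ⟨φ⟩; exact imp_refl φ
  le_trans := by rintro ⟨φ⟩ ⟨ψ⟩ ⟨χ⟩ h h'; exact imp_trans h h'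
  le_antisymm := by rintro ⟨φ⟩ ⟨ψ⟩ h h'; exact Quotient.sound (iff_iff.2 ⟨h, h'⟩)
  sup := Quotient.map₂ Formula.or fun _ _ h _ _ h' => iff_iff.2
    ⟨or_imp (imp_trans (iff_iff.1 h).1 (or_inl _ _)) (imp_trans (iff_iff.1 h').1 (or_inr _ _)),
      or_imp (imp_trans (iff_iff.1 h).2 (or_inl _ _)) (imp_trans (iff_iff.1 h').2 (or_inr _ _))⟩
  le_sup_left := by rintro ⟨φ⟩ ⟨ψ⟩; exact or_inl φ ψ
  le_sup_right := by rintro ⟨φ⟩ ⟨ψ⟩; exact or_inr φ ψ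
  sup_le := by rintro ⟨φ⟩ ⟨ψ⟩ ⟨χ⟩ h h'; exact or_imp h h'
  inf := Quotient.map₂ Formula.and fun _ _ h _ _ h' => iff_iff.2
    ⟨imp_and (imp_trans (and_left _ _) (iff_iff.1 h).1) (imp_trans (and_right _ _) (iff_iff.1 h').1),
      imp_and (imp_trans (and_left _ _) (iff_iff.1 h).2)
        (imp_trans (and_right _ _) (iff_iff.1 h').2)⟩
  inf_le_left := by rintro ⟨φ⟩ ⟨ψ⟩; exact and_left φ ψ
  inf_le_right := by rintro ⟨φ⟩ ⟨ψ⟩; exact and_right φ ψ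
  le_inf := by rintro ⟨φ⟩ ⟨ψ⟩ ⟨χ⟩ h h'; exact imp_and h h'
  le_sup_inf := by rintro ⟨φ⟩ ⟨ψ⟩ ⟨χ⟩; exact distrib φ ψ χ
  compl := Quotient.map Formula.neg fun _ _ h => iff_iff.2
    ⟨contra (iff_iff.1 h).2, contra (iff_iff.1 h).1⟩
  top := Lindenbaum.mk T (Formula.verum γ)
  bot := Lindenbaum.mk T (Formula.verum γ).neg
  inf_compl_le_bot := by rintro ⟨φ⟩; exact explode φ _
  top_le_sup_compl := by rintro ⟨φ⟩; exact weaken (em φ)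
  le_top := by
    rintro ⟨φ⟩
    exact weaken Provable.verum
  bot_le := by
    rintro ⟨φ⟩
    exact imp_trans (imp_and (weaken Provable.verum) (imp_refl _)) (explode (Formula.verum γ) φ)

/-! ### Elementary embeddings and Woodin cardinals -/

/-- The only symbol of the language of set theory. -/
inductive SetRel : ℕ → Type
  | mem : SetRel 2

/-- The first-order language of set theory. -/
def setLang : FirstOrder.Language := ⟨fun _ => Empty, SetRel⟩

/-- The universe of sets as a structure for the language of set theory. -/
instance : setLang.Structure ZFSet.{u} where
  funMap f := Empty.elim f
  RelMap | SetRel.mem, v => v 0 ∈ v 1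

/-- A class of sets as a structure, with the true membership relation. -/
instance (M : Set ZFSet.{u}) : setLang.Structure M where
  funMap f := Empty.elim f
  RelMap | SetRel.mem, v => (v 0).1 ∈ (v 1).1

/-- `κ` is the least ordinal moved by `j`. -/
def IsCriticalPoint (j : ZFSet.{u} → ZFSet.{u}) (κ : Ordinal.{u}) : Prop :=
  (∀ α < κ, j (toZFSet α) = toZFSet α) ∧ j (toZFSet κ) ≠ toZFSet κ

/-- The map `j` into the transitive class `M` is `A, l`-strong. -/
def IsStrongFor (M : Set ZFSet.{u}) (j : ZFSet.{u} → ZFSet.{u}) (A : ZFSet.{u})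
    (l : Ordinal.{u}) : Prop :=
  (∀ x ∈ vonNeumann l, x ∈ M) ∧ j A ∩ vonNeumann l = A ∩ vonNeumann l

/-- `δ` is a Woodin cardinal: for every `A ⊆ V_δ` there is `κ < δ` such that for arbitrarily large
`l < δ` there is an `A, l`-strong elementary embedding of the universe into a transitive class
with critical point `κ`. -/
def IsWoodin (δ : Cardinal.{u}) : Prop :=
  ∀ A : ZFSet.{u}, A ⊆ vonNeumann δ.ord → ∃ κ < δ.ord, ∀ μ < δ.ord, ∃ l, μ ≤ l ∧ l < δ.ord ∧
    ∃ (M : Set ZFSet.{u}) (j : setLang.ElementaryEmbedding ZFSet.{u} M),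
      (∀ x ∈ M, ∀ y ∈ x, y ∈ M) ∧ IsCriticalPoint (fun x => (j x).1) κ ∧
        IsStrongFor M (fun x => (j x).1) A l

/-! ### Extenders -/

/-- The projection: restriction of an increasing function to a smaller domain. -/
def proj {l κ : Ordinal.{u}} {p q : Set.Iio l → Prop} (h : ∀ ξ, p ξ → q ξ)
    (v : {ξ // q ξ} ↪o Set.Iio κ) : {ξ // p ξ} ↪o Set.Iio κ :=
  (Subtype.orderEmbedding h).trans v

/-- A `(κ, l)`-extender, for uncountable cardinals `κ < l`. For a finite `s ⊆ l`, the space of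
increasing functions `s → κ` stands for the set of `|s|`-element subsets of `κ`, each of them being
enumerated along `s` in the increasing order. -/
structure Extender where
  /-- the critical point -/
  κ : Cardinal.{u}
  /-- the length -/
  l : Cardinal.{u}
  aleph0_lt : ℵ₀ < κ
  lt : κ < l
  /-- the ultrafilters -/
  E (s : Finset (Set.Iio l.ord)) : Ultrafilter (s ↪o Set.Iio κ.ord)
  nonprincipal (s : Finset (Set.Iio l.ord)) :
    (∃ ξ ∈ s, κ.ord ≤ ξ.1) → ∀ v, {v} ∉ E s
  complete (s : Finset (Set.Iio l.ord)) : ∀ μ < κ.ord,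
    ∀ X : Set.Iio μ → Set (s ↪o Set.Iio κ.ord), (∀ i, X i ∈ E s) → (⋂ i, X i) ∈ E s
  coherent (s t : Finset (Set.Iio l.ord)) (h : s ⊆ t) :
    ∀ X : Set (s ↪o Set.Iio κ.ord), X ∈ E s ↔ {v | proj (fun _ hx => h hx) v ∈ X} ∈ E t
  normal (s : Finset (Set.Iio l.ord)) (i : s) (f : (s ↪o Set.Iio κ.ord) → Set.Iio κ.ord) :
    {v | f v < v i} ∈ E s → ∃ ξ < i.1, ∃ k : (insert ξ s : Finset (Set.Iio l.ord)),
      {v | f (proj (fun _ hx => Finset.mem_insert_of_mem hx) v) = v k} ∈ E (insert ξ s)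
  countablyComplete (s : ℕ → Finset (Set.Iio l.ord))
    (X : ∀ n, Set (s n ↪o Set.Iio κ.ord)) : (∀ n, X n ∈ E (s n)) →
      ∃ h : {ξ // ∃ n, ξ ∈ s n} ↪o Set.Iio κ.ord, ∀ n, proj (fun _ hx => ⟨n, hx⟩) h ∈ X n

namespace Extender

/-- Representatives of the elements of the direct limit of the ultrapowers of the universe by the
ultrafilters of the extender. -/
def Rep (E : Extender.{u}) : Type (u + 1) :=
  Σ s : Finset (Set.Iio E.l.ord), (s ↪o Set.Iio E.κ.ord) → ZFSet.{u}

/-- The relation that `R` induces on the direct limit of the ultrapowers: `R` holds between the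
representing functions, moved to a common index, almost everywhere. -/
def Rep.Holds {E : Extender.{u}} (R : ZFSet.{u} → ZFSet.{u} → Prop) (a b : E.Rep) : Prop :=
  {v | R (a.2 (proj (fun _ hx => Finset.mem_union_left _ hx) v))
    (b.2 (proj (fun _ hx => Finset.mem_union_right _ hx) v))} ∈ E.E (a.1 ∪ b.1)

/-- The transitive collapse of the ultrapower of the universe by the extender. It is unique, and it
exists by the countable completeness of the extender. -/
structure Collapse (E : Extender.{u}) where
  toFun : E.Rep → ZFSet.{u}
  eq_iff : ∀ a b, toFun a = toFun b ↔ Rep.Holds (fun x y => x = y) a b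
  mem_iff : ∀ a b, toFun a ∈ toFun b ↔ Rep.Holds (fun x y => x ∈ y) a b
  trans : ∀ a, ∀ x ∈ toFun a, ∃ b, toFun b = x

/-- The (transitive) ultrapower of the universe by the extender. -/
def Collapse.ult {E : Extender.{u}} (c : E.Collapse) : Set ZFSet.{u} := Set.range c.toFun

/-- The ultrapower embedding, given by the constant functions. -/
def Collapse.emb {E : Extender.{u}} (c : E.Collapse) (x : ZFSet.{u}) : ZFSet.{u} :=
  c.toFun ⟨∅, fun _ => x⟩

/-- The embedding of the universe into its ultrapower by `E` has critical point `κ` and is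
`A, l`-strong. -/
def IsStrong (E : Extender.{u}) (κ : Ordinal.{u}) (A : ZFSet.{u}) (l : Ordinal.{u}) : Prop :=
  ∃ c : E.Collapse, IsCriticalPoint c.emb κ ∧ IsStrongFor c.ult c.emb A l

end Extender

/-- The extenders in `ℰ` witness that `A` reflects to `κ` (below `δ`). -/
def ReflectsVia (δ : Cardinal.{u}) (ℰ : Set Extender.{u}) (A : ZFSet.{u}) (κ : Ordinal.{u}) :
    Prop :=
  κ < δ.ord ∧ ∀ l, κ < l → l < δ.ord → ∃ E ∈ ℰ, E.IsStrong κ A l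

/-- `ℰ` is a system of extenders in `V_δ` which witnesses that `δ` is Woodin. Since `δ` is a limit
ordinal, a `(κ, l)`-extender is an element of `V_δ` if and only if `l < δ`. -/
def WitnessesWoodin (δ : Cardinal.{u}) (ℰ : Set Extender.{u}) : Prop :=
  (∀ E ∈ ℰ, E.l < δ) ∧
    ∀ A : ZFSet.{u}, A ⊆ vonNeumann δ.ord → ∃ κ, ReflectsVia δ ℰ A κ

/-! ### The extender algebra -/

/-- The sentences `⋁_{ξ<κ} φ_ξ ↔ ⋁_{ξ<l} φ_ξ`, where `⟨φ_ξ : ξ < δ⟩` reflects to `κ` as witnessed by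
the extenders in `ℰ`, and `κ ≤ l < δ`. -/
def extenderAxioms (δ γ : Cardinal.{u}) (ℰ : Set Extender.{u}) : Set (Formula δ γ) :=
  {ψ | ∃ (φ : Set.Iio δ.ord → Formula δ γ) (κ l : Set.Iio δ.ord),
    ReflectsVia δ ℰ (codeSeq φ) κ.1 ∧ κ ≤ l ∧ ψ = (initialOr φ κ).iff (initialOr φ l)}

/-- The theory of the extender algebra. -/
def extenderTheory (δ γ : Cardinal.{u}) (ℰ : Set Extender.{u}) : Set (Formula δ γ) :=
  deductiveClosure (extenderAxioms δ γ ℰ)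

/-- The extender algebra with `γ` generators. -/
abbrev Algebra (δ γ : Cardinal.{u}) (ℰ : Set Extender.{u}) : Type (u + 1) :=
  Lindenbaum (extenderTheory δ γ ℰ)

/-- The `δ`-chain condition: every antichain of nonzero elements has fewer than `δ` elements. -/
def HasChainCondition (δ : Cardinal.{u}) (B : Type (u + 1)) [BooleanAlgebra B] : Prop :=
  ∀ A : Set B, (∀ a ∈ A, a ≠ ⊥) → (∀ a ∈ A, ∀ b ∈ A, a ≠ b → a ⊓ b = ⊥) →
    Cardinal.mk A < Cardinal.lift.{u + 1} δ

/-- A Boolean algebra is complete if every subset has a least upper bound and a greatest lower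
bound. -/
def IsCompleteAlgebra (B : Type (u + 1)) [BooleanAlgebra B] : Prop :=
  ∀ S : Set B, (∃ a, IsLUB S a) ∧ ∃ b, IsGLB S b

end ExtenderAlgebra

/-!
The algebra has joins of fewer than `δ` elements, because a disjunction of length `κ < δ` is a
formula whose class is the supremum of the classes of its members (`Lindenbaum.isLUB_bigOr`).

For the chain condition, suppose that there is an antichain of `δ` nonzero classes, represented by
formulas `φ_ξ`, `ξ < δ`. Since `δ` is regular and `γ ≤ δ`, the sequence is a subset of `V_δ`
(`Formula.codeSeq_subset_vonNeumann`), so it reflects to some `κ < δ`. The axiom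
`⋁_{ξ<κ} φ_ξ ↔ ⋁_{ξ<κ+1} φ_ξ` puts `[φ_κ]` below the join of the `[φ_ξ]`, `ξ < κ`, all of which are
disjoint from it; hence `[φ_κ] = 0`, a contradiction (`Algebra.hasChainCondition`).

A Boolean algebra with the `δ`-chain condition and with joins of fewer than `δ` elements is complete
(`isCompleteAlgebra_of_hasChainCondition`): the join of a set `S` is the join of a maximal antichain
among the nonzero elements that lie below some member of `S`.
-/

namespace ExtenderAlgebra

open Cardinal Ordinal ZFSet Formula

/-! ### Formulas as elements of `V_δ` -/

theorem rank_pair_lt {x y : ZFSet.{u}} {o : Ordinal.{u}} (ho : Order.IsSuccLimit o)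
    (hx : rank x < o) (hy : rank y < o) : rank (pair x y) < o := by
  simp only [pair, ZFSet.rank_pair, ZFSet.rank_singleton, max_lt_iff]
  exact ⟨ho.succ_lt (ho.succ_lt hx), ho.succ_lt (max_lt (ho.succ_lt hx) (ho.succ_lt hy))⟩

/-- The graph of a sequence of length less than the regular cardinal `δ` of elements of `V_δ` is
an element of `V_δ`. -/
theorem rank_range_pair_lt {δ : Cardinal.{u}} (hδ : δ.IsRegular) {κ : Ordinal.{u}}
    (hκ : κ < δ.ord) (f : Set.Iio κ → ZFSet.{u}) (hf : ∀ ξ, rank (f ξ) < δ.ord) :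
    rank (ZFSet.range fun ξ : Set.Iio κ => pair (toZFSet ξ.1) (f ξ)) < δ.ord := by
  have hlim : Order.IsSuccLimit δ.ord := isSuccLimit_ord hδ.aleph0_le
  rw [ZFSet.rank_range]
  refine lift_iSup_add_one_lt_of_lt_cof ?_ fun ξ => ?_
  · rw [Cardinal.mk_Iio_ordinal, ← Ordinal.lift_cof, hδ.cof_ord]
    rw [Cardinal.lift_lift, Cardinal.lift_lt]
    exact Cardinal.lt_ord.1 hκ
  · exact rank_pair_lt hlim (by simpa using lt_trans (Set.mem_Iio.1 ξ.2) hκ) (hf ξ)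

namespace Formula

variable {δ γ : Cardinal.{u}}

theorem rank_code_lt (hδ : δ.IsRegular) (hγ : γ ≤ δ) (φ : Formula δ γ) :
    rank φ.code < δ.ord := by
  have hlim : Order.IsSuccLimit δ.ord := isSuccLimit_ord hδ.aleph0_le
  have hnat (n : ℕ) : rank (toZFSet.{u} n) < δ.ord := by
    rw [rank_toZFSet, Cardinal.lt_ord, Ordinal.card_nat]
    exact hδ.nat_lt n
  induction φ with
  | var ξ =>
    refine rank_pair_lt hlim (mod_cast hnat 0) ?_
    rw [rank_toZFSet]
    exact lt_of_lt_of_le (Set.mem_Iio.1 ξ.2) (Cardinal.ord_le_ord.2 hγ)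
  | neg φ ih => exact rank_pair_lt hlim (mod_cast hnat 1) ih
  | and φ ψ ih ih' => exact rank_pair_lt hlim (mod_cast hnat 2) (rank_pair_lt hlim ih ih')
  | or φ ψ ih ih' => exact rank_pair_lt hlim (mod_cast hnat 3) (rank_pair_lt hlim ih ih')
  | imp φ ψ ih ih' => exact rank_pair_lt hlim (mod_cast hnat 4) (rank_pair_lt hlim ih ih')
  | iff φ ψ ih ih' => exact rank_pair_lt hlim (mod_cast hnat 5) (rank_pair_lt hlim ih ih')
  | bigAnd κ φ ih =>
    exact rank_pair_lt hlim (mod_cast hnat 6) (rank_range_pair_lt hδ κ.2 _ ih)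
  | bigOr κ φ ih =>
    exact rank_pair_lt hlim (mod_cast hnat 7) (rank_range_pair_lt hδ κ.2 _ ih)

theorem codeSeq_subset_vonNeumann (hδ : δ.IsRegular) (hγ : γ ≤ δ)
    (φ : Set.Iio δ.ord → Formula δ γ) : codeSeq φ ⊆ vonNeumann δ.ord := by
  intro x hx
  obtain ⟨ξ, rfl⟩ := ZFSet.mem_range.1 hx
  exact mem_vonNeumann.2 (rank_pair_lt (isSuccLimit_ord hδ.aleph0_le)
    (by simpa using Set.mem_Iio.1 ξ.2) (rank_code_lt hδ hγ _))

end Formula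

/-! ### Small joins in the Lindenbaum algebra -/

namespace Lindenbaum

variable {δ γ : Cardinal.{u}} {T : Set (Formula δ γ)}

theorem mk_eq_mk {φ ψ : Formula δ γ} : mk T φ = mk T ψ ↔ Provable T (φ.iff ψ) :=
  Quotient.eq (r := equivMod T)

theorem mk_surjective : Function.Surjective (mk T) := Quotient.mk_surjective

variable [Fact δ.IsRegular]

theorem mk_le_mk {φ ψ : Formula δ γ} : mk T φ ≤ mk T ψ ↔ Provable T (φ.imp ψ) := Iff.rfl

theorem mk_neg (φ : Formula δ γ) : mk T φ.neg = (mk T φ)ᶜ := rfl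

theorem isLUB_bigOr (κ : Set.Iio δ.ord) (φ : Set.Iio κ.1 → Formula δ γ) :
    IsLUB (Set.range fun ξ => mk T (φ ξ)) (mk T (bigOr κ φ)) := by
  -- The calculus has rules for conjunctions only; disjunctions are handled by complementation.
  have hneg : (mk T (bigOr κ φ))ᶜ = mk T (bigAnd κ fun ξ => (φ ξ).neg) :=
    (mk_eq_mk.2 (Provable.bigAnd_neg κ φ)).symm
  constructor
  · rintro _ ⟨η, rfl⟩
    rw [← compl_le_compl_iff_le, hneg]
    exact Provable.bigAnd_elim κ (fun ξ => (φ ξ).neg) η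
  · intro b hb
    obtain ⟨χ, rfl⟩ := mk_surjective b
    rw [← compl_le_compl_iff_le, hneg, ← mk_neg]
    refine Provable.bigAnd_rule_imp _ _ _ fun ξ => mk_le_mk.1 ?_
    rw [mk_neg, mk_neg]
    exact compl_le_compl (hb ⟨ξ, rfl⟩)

theorem exists_isLUB_of_mk_lt (S : Set (Lindenbaum T))
    (hS : Cardinal.mk S < Cardinal.lift.{u + 1} δ) : ∃ a, IsLUB S a := by
  obtain ⟨c, hc, hcS⟩ := Cardinal.lt_lift_iff.1 hS
  have hcard : Cardinal.mk (Set.Iio c.ord) = Cardinal.mk S := by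
    rw [Cardinal.mk_Iio_ordinal, Cardinal.card_ord, hcS]
  obtain ⟨e⟩ := Cardinal.eq.1 hcard
  choose rep hrep using mk_surjective (T := T)
  have h := isLUB_bigOr (T := T) ⟨c.ord, Cardinal.ord_lt_ord.2 hc⟩ fun ξ => rep (e ξ)
  have hrange : (Set.range fun ξ => mk T (rep (e ξ))) = S := by
    simp only [hrep]
    exact (e.surjective.range_comp Subtype.val).trans Subtype.range_coe
  exact ⟨_, hrange ▸ h⟩

end Lindenbaum

/-! ### Completeness from the chain condition -/

theorem isCompleteAlgebra_of_hasChainCondition {δ : Cardinal.{u}} {B : Type (u + 1)}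
    [BooleanAlgebra B] (hcc : HasChainCondition δ B)
    (hsup : ∀ S : Set B, Cardinal.mk S < Cardinal.lift.{u + 1} δ → ∃ a, IsLUB S a) :
    IsCompleteAlgebra B := by
  have key (S : Set B) : ∃ a, IsLUB S a := by
    let P : Set (Set B) := {A | (∀ a ∈ A, a ≠ ⊥ ∧ ∃ s ∈ S, a ≤ s) ∧
      ∀ a ∈ A, ∀ b ∈ A, a ≠ b → a ⊓ b = ⊥}
    obtain ⟨A, hA⟩ : ∃ A, Maximal (· ∈ P) A := by
      refine zorn_subset P fun c hc hchain => ⟨⋃₀ c, ⟨?_, ?_⟩, fun s => Set.subset_sUnion_of_mem⟩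
      · rintro a ⟨A, hA, ha⟩
        exact (hc hA).1 a ha
      · rintro a ⟨A, hA, ha⟩ b ⟨A', hA', hb⟩ hab
        rcases hchain.total hA hA' with h | h
        · exact (hc hA').2 a (h ha) b hb hab
        · exact (hc hA).2 a ha b (h hb) hab
    obtain ⟨a, ha⟩ := hsup A (hcc A (fun x hx => (hA.prop.1 x hx).1) hA.prop.2)
    refine ⟨a, fun s hs => ?_, fun c hc => ha.2 fun x hx => ?_⟩
    · -- The part of `s` outside `a` is disjoint from `A`, so maximality forces it to be zero.
      by_contra hsa
      have hne : s ⊓ aᶜ ≠ ⊥ := fun h => hsa (by rwa [← sdiff_eq, sdiff_eq_bot_iff] at h)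
      have hdisj : ∀ x ∈ A, (s ⊓ aᶜ) ⊓ x = ⊥ := fun x hx =>
        (disjoint_compl_left.mono inf_le_right (ha.1 hx)).eq_bot
      have hmem : insert (s ⊓ aᶜ) A ∈ P := by
        constructor
        · rintro x (rfl | hx)
          · exact ⟨hne, s, hs, inf_le_left⟩
          · exact hA.prop.1 x hx
        · rintro x (rfl | hx) y (rfl | hy) hxy
          · exact absurd rfl hxy
          · exact hdisj y hy
          · rw [inf_comm]
            exact hdisj x hx
          · exact hA.prop.2 x hx y hy hxy
      have hin : s ⊓ aᶜ ∈ A := hA.le_of_ge hmem (Set.subset_insert _ _) (Set.mem_insert _ _)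
      exact hne (by simpa using hdisj _ hin)
    · obtain ⟨s, hs, hxs⟩ := (hA.prop.1 x hx).2
      exact hxs.trans (hc hs)
  refine fun S => ⟨key S, ?_⟩
  obtain ⟨b, hb⟩ := key (lowerBounds S)
  exact ⟨b, isLUB_lowerBounds.1 hb⟩

/-! ### The chain condition of the extender algebra -/

/-- If the sequence `⟨φ_ξ : ξ < δ⟩` reflects to `κ`, then the class of `φ_κ` is below every upper
bound of the classes of the earlier formulas. -/
theorem Algebra.mk_le_of_reflectsVia {δ γ : Cardinal.{u}} [hδ : Fact δ.IsRegular]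
    {ℰ : Set Extender.{u}} (φ : Set.Iio δ.ord → Formula δ γ) (κ : Set.Iio δ.ord)
    (hκ : ReflectsVia δ ℰ (codeSeq φ) κ.1) {b : Algebra δ γ ℰ}
    (hb : ∀ ξ < κ, Lindenbaum.mk (extenderTheory δ γ ℰ) (φ ξ) ≤ b) :
    Lindenbaum.mk (extenderTheory δ γ ℰ) (φ κ) ≤ b := by
  have hlt : Order.succ κ.1 < δ.ord := (isSuccLimit_ord hδ.out.aleph0_le).succ_lt κ.2
  have hax := Lindenbaum.mk_eq_mk.2 (Provable.ax (T := extenderTheory δ γ ℰ) (Provable.ax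
    ⟨φ, κ, ⟨Order.succ κ.1, hlt⟩, hκ, Order.le_succ κ.1, rfl⟩))
  have hle : Lindenbaum.mk (extenderTheory δ γ ℰ) (φ κ) ≤
      Lindenbaum.mk _ (initialOr φ ⟨Order.succ κ.1, hlt⟩) :=
    (Lindenbaum.isLUB_bigOr _ _).1 ⟨⟨κ.1, Order.lt_succ κ.1⟩, rfl⟩
  refine (hle.trans_eq hax.symm).trans ((Lindenbaum.isLUB_bigOr _ _).2 ?_)
  rintro _ ⟨ξ, rfl⟩
  exact hb _ ξ.2

theorem Algebra.hasChainCondition {δ γ : Cardinal.{u}} [hδ : Fact δ.IsRegular] (hγ : γ ≤ δ)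
    {ℰ : Set Extender.{u}} (hℰ : WitnessesWoodin δ ℰ) :
    HasChainCondition δ (Algebra δ γ ℰ) := by
  intro A hne hdisj
  by_contra hA
  have hcard : Cardinal.mk (Set.Iio δ.ord) ≤ Cardinal.mk A := by
    rw [Cardinal.mk_Iio_ordinal, Cardinal.card_ord]
    exact not_lt.1 hA
  obtain ⟨e⟩ := hcard
  choose rep hrep using Lindenbaum.mk_surjective (T := extenderTheory δ γ ℰ)
  obtain ⟨κ, hκ⟩ := hℰ.2 _ (codeSeq_subset_vonNeumann hδ.out hγ fun ξ => rep (e ξ))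
  have hle := Algebra.mk_le_of_reflectsVia (fun ξ => rep (e ξ)) ⟨κ, hκ.1⟩ hκ
    (b := (e ⟨κ, hκ.1⟩ : Algebra δ γ ℰ)ᶜ) fun ξ hξ => by
      rw [hrep, le_compl_iff_disjoint_right, disjoint_iff]
      exact hdisj _ (e ξ).2 _ (e _).2 fun h => hξ.ne (e.injective (Subtype.ext h))
  rw [hrep, le_compl_self] at hle
  exact hne _ (e _).2 hle

end ExtenderAlgebra

theorem mainTheorem10 (δ γ : Cardinal.{u}) [Fact δ.IsRegular] (hγ : γ ≤ δ)
    (hδ : ExtenderAlgebra.IsWoodin δ) (ℰ : Set ExtenderAlgebra.Extender.{u})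
    (hℰ : ExtenderAlgebra.WitnessesWoodin δ ℰ) :
    ExtenderAlgebra.HasChainCondition δ (ExtenderAlgebra.Algebra δ γ ℰ) ∧
      ExtenderAlgebra.IsCompleteAlgebra (ExtenderAlgebra.Algebra δ γ ℰ) :=
  have hcc := ExtenderAlgebra.Algebra.hasChainCondition hγ hℰ
  ⟨hcc, ExtenderAlgebra.isCompleteAlgebra_of_hasChainCondition hcc
    ExtenderAlgebra.Lindenbaum.exists_isLUB_of_mk_lt⟩
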